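/- Let $X$ be a metric space that is hereditarily Baire (every closed subspace of $X$ is a Baire space), let $Y$ be a metric space, and let $f\colon X\to Y$ be a function. Write $\varrho$ and $d$ for the metrics of $X$ and $Y$; diameters take values in $[0,\infty]$. A family $\mathcal A$ of subsets of $X$ is called discrete if every point of $X$ has a neighborhood that meets at most one member of $\mathcal A$, and $\sigma$-discrete if it is a countable union of discrete families. Consider the following properties of $f$: (GLP) for every $\varepsilon>0$ there is a $\sigma$-discrete family $\mathcal A$ of closed subsets of $X$ with $X=\bigcup\mathcal A$ and $\operatorname{diam} f(A)\le\varepsilon$ for all $A\in\mathcal A$; (WS) for every $\varepsilon>0$ there are open sets $V_x\ni x$ $(x\in X)$ such that for all $x,y\in X$, if $x\in V_y$ and $y\in V_x$, then $d(f(x),f(y))<\varepsilon$; (LTZ) for every $\varepsilon>0$ there is a function $\delta\colon X\to(0,\infty)$ such that for all $x,y\in X$, if $\varrho(x,y)<\min\{\delta(x),\delta(y)\}$, then $d(f(x),f(y))<\varepsilon$; (PCP) for every nonempty closed set $F\subseteq X$ the restriction $f\restriction_F$ has a point of continuity; (Borel 1) for every open set $V\subseteq Y$ the preimage $f^{-1}(V)$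 is an $F_\sigma$-set in $X$; (Frag) for every $\varepsilon>0$ and every nonempty closed set $F\subseteq X$ there is an open set $U\subseteq X$ with $U\cap F\ne\emptyset$ and $\operatorname{diam} f(U\cap F)<\varepsilon$; (LP) for every $\varepsilon>0$ there is a sequence $(X_n)_{n\in\mathbb N}$ of closed sets covering $X$ with $\operatorname{diam} f(X_n)\le\varepsilon$ for all $n\in\mathbb N$. Then $$\text{(GLP)}\Leftrightarrow\text{(WS)}\Leftrightarrow\text{(LTZ)}\Leftrightarrow\text{(PCP)}\Leftrightarrow\text{(Borel 1)}\Leftrightarrow\text{(Frag)}.$$ Moreover, if $X$ or $Y$ is separable, then $$\text{(LP)}\Leftrightarrow\text{(GLP)}\Leftrightarrow\text{(WS)}\Leftrightarrow\text{(LTZ)}\Leftrightarrow\text{(PCP)}\Leftrightarrow\text{(Borel 1)}\Leftrightarrow\text{(Frag)}.$$ -/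

import Mathlib

open Set Topology

/-- Every closed subset, with the subspace topology, is a Baire space. -/
def HereditarilyBaire (X : Type*) [TopologicalSpace X] : Prop :=
  ∀ F : Set X, IsClosed F → BaireSpace F

/-- Every point has a neighbourhood that meets at most one member of the family. -/
def IsDiscreteFamily {X : Type*} [TopologicalSpace X] (𝒜 : Set (Set X)) : Prop :=
  ∀ x : X, ∃ U ∈ 𝓝 x, {A ∈ 𝒜 | (U ∩ A).Nonempty}.Subsingleton

/-- A countable union of discrete families. -/
def IsSigmaDiscreteFamily {X : Type*} [TopologicalSpace X] (𝒜 : Set (Set X)) : Prop :=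
  ∃ ℬ : ℕ → Set (Set X), (∀ n, IsDiscreteFamily (ℬ n)) ∧ 𝒜 = ⋃ n, ℬ n

/-- A countable union of closed sets. -/
def IsFSigma {X : Type*} [TopologicalSpace X] (s : Set X) : Prop :=
  ∃ C : ℕ → Set X, (∀ n, IsClosed (C n)) ∧ s = ⋃ n, C n

/-- (WS) The function is weakly separated: `V` is a neighbourhood assignment. -/
def IsWeaklySeparated {X Y : Type*} [TopologicalSpace X] [MetricSpace Y] (f : X → Y) : Prop :=
  ∀ ε : ℝ, 0 < ε → ∃ V : X → Set X, (∀ x, IsOpen (V x) ∧ x ∈ V x) ∧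
    ∀ x y, (x, y) ∈ V y ×ˢ V x → dist (f x) (f y) < ε

/-- (Frag) The function is fragmentable. The diameter takes values in `[0, ∞]`. -/
def IsFragmentable {X Y : Type*} [TopologicalSpace X] [MetricSpace Y] (f : X → Y) : Prop :=
  ∀ ε : ℝ, 0 < ε → ∀ F : Set X, F.Nonempty → IsClosed F →
    ∃ U : Set X, IsOpen U ∧ (U ∩ F).Nonempty ∧ Metric.ediam (f '' (U ∩ F)) < ENNReal.ofReal ε

/-- (LP) The Lebesgue property. -/
def HasLebesgueProperty {X Y : Type*} [TopologicalSpace X] [MetricSpace Y] (f : X → Y) : Prop :=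
  ∀ ε : ℝ, 0 < ε → ∃ A : ℕ → Set X, (⋃ n, A n) = univ ∧
    ∀ n, IsClosed (A n) ∧ Metric.ediam (f '' A n) ≤ ENNReal.ofReal ε

/-- (GLP) The generalized Lebesgue property. -/
def HasGeneralizedLebesgueProperty {X Y : Type*} [TopologicalSpace X] [MetricSpace Y]
    (f : X → Y) : Prop :=
  ∀ ε : ℝ, 0 < ε → ∃ 𝒜 : Set (Set X), IsSigmaDiscreteFamily 𝒜 ∧ ⋃₀ 𝒜 = univ ∧
    ∀ A ∈ 𝒜, IsClosed A ∧ Metric.ediam (f '' A) ≤ ENNReal.ofReal ε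

/-- (PCP) The point of continuity property. -/
def HasPointOfContinuityProperty {X Y : Type*} [TopologicalSpace X] [MetricSpace Y]
    (f : X → Y) : Prop :=
  ∀ F : Set X, F.Nonempty → IsClosed F → ∃ x : F, ContinuousAt (fun z : F => f z) x

/-- (Borel 1) Preimages of open sets are `F_σ`. -/
def IsBorelOne {X Y : Type*} [TopologicalSpace X] [MetricSpace Y] (f : X → Y) : Prop :=
  ∀ V : Set Y, IsOpen V → IsFSigma (f ⁻¹' V)

/-- (LTZ) The Lee-Tang-Zhao property. -/
def HasLTZProperty {X Y : Type*} [MetricSpace X] [MetricSpace Y] (f : X → Y) : Prop :=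
  ∀ ε : ℝ, 0 < ε → ∃ δ : X → ℝ, (∀ x, 0 < δ x) ∧
    ∀ x y, dist x y < min (δ x) (δ y) → dist (f x) (f y) < ε

/-! ### Discrete families, Baire category and `F_σ` sets. -/

section Discrete

variable {X : Type*} [TopologicalSpace X]

/-! (LTZ) is (WS) with balls as neighbourhoods. It yields closed sets `C n` covering `X` on which
points closer than `1/(n+1)` have `ε`-close images. Cutting `C n` by a σ-discrete closed cover of
that mesh gives (GLP); Baire category applied to the `C n` gives (Frag). (GLP) returns to (WS) by
letting `V x` avoid the families before the first one covering `x`, and (Frag) returns to (WS)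
because the largest open set on which `f` is weakly separated cannot be proper.

(Frag) and (PCP) are linked by intersecting dense open sets of small oscillation. (GLP) gives (Borel
1), since discrete unions of closed sets are closed. The hard step is (Borel 1) to (Frag): otherwise
a sequence with uniformly separated values can be built whose closure contains two disjoint dense
`G_δ` sets, contradicting Baire.

If `X` or `Y` is separable, countably many balls replace the σ-discrete family and give (LP). -/

theorem IsDiscreteFamily.locallyFinite {𝒜 : Set (Set X)} (h : IsDiscreteFamily 𝒜) :
    LocallyFinite (fun A : 𝒜 => (A : Set X)) := by
  intro x
  obtain ⟨U, hU, hs⟩ := h x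
  refine ⟨U, hU, Set.Subsingleton.finite ?_⟩
  rintro ⟨A, hA⟩ hAU ⟨B, hB⟩ hBU
  refine Subtype.ext (hs ⟨hA, ?_⟩ ⟨hB, ?_⟩)
  · rw [inter_comm]; exact hAU
  · rw [inter_comm]; exact hBU

theorem IsDiscreteFamily.mono {𝒜 ℬ : Set (Set X)} (h : IsDiscreteFamily ℬ) (hs : 𝒜 ⊆ ℬ) :
    IsDiscreteFamily 𝒜 := by
  intro x
  obtain ⟨U, hU, hsub⟩ := h x
  exact ⟨U, hU, hsub.anti fun A hA => ⟨hs hA.1, hA.2⟩⟩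

theorem IsDiscreteFamily.isClosed_sUnion {𝒜 : Set (Set X)} (h : IsDiscreteFamily 𝒜)
    (hc : ∀ A ∈ 𝒜, IsClosed A) : IsClosed (⋃₀ 𝒜) := by
  rw [sUnion_eq_iUnion]
  exact h.locallyFinite.isClosed_iUnion fun A => hc A A.2

theorem isDiscreteFamily_singleton (A : Set X) : IsDiscreteFamily {A} := fun _ =>
  ⟨univ, Filter.univ_mem, fun _ hB _ hC => hB.1.trans hC.1.symm⟩

/-- A set covered, inside an open set, by countably many closed sets meets some open set within
one of them. -/
theorem exists_isOpen_inter_subset_of_subset_iUnion {ι : Type*} [Countable ι] {F U : Set X}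
    [BaireSpace F] (hU : IsOpen U) (hne : (U ∩ F).Nonempty) {C : ι → Set X}
    (hC : ∀ i, IsClosed (C i)) (hsub : U ∩ F ⊆ ⋃ i, C i) :
    ∃ i, ∃ W ⊆ U, IsOpen W ∧ (W ∩ F).Nonempty ∧ W ∩ F ⊆ C i := by
  -- The extra index `none` carries the complement of `U`, so that the closed sets cover all of `F`.
  let D : Option ι → Set F := fun o => o.elim ((↑) ⁻¹' Uᶜ) fun i => (↑) ⁻¹' C i
  have hD : ∀ o, IsClosed (D o) := by
    rintro (_ | i)
    · exact hU.isClosed_compl.preimage continuous_subtype_val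
    · exact (hC i).preimage continuous_subtype_val
  have hcov : ⋃ o, D o = univ := by
    refine eq_univ_of_forall fun x => ?_
    by_cases hx : (x : X) ∈ U
    · obtain ⟨i, hi⟩ := mem_iUnion.1 (hsub ⟨hx, x.2⟩)
      exact mem_iUnion.2 ⟨some i, hi⟩
    · exact mem_iUnion.2 ⟨none, hx⟩
  have hdense := dense_iUnion_interior_of_closed hD hcov
  obtain ⟨x, hxU, hxF⟩ := hne
  obtain ⟨z, hzU, hz⟩ := hdense.inter_open_nonempty (Subtype.val ⁻¹' U)
    (hU.preimage continuous_subtype_val) ⟨⟨x, hxF⟩, hxU⟩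
  obtain ⟨o, ho⟩ := mem_iUnion.1 hz
  rcases o with _ | i
  · exact absurd hzU (interior_subset ho)
  · obtain ⟨W, hW, hWe⟩ := isOpen_induced_iff.1 (isOpen_interior (s := D (some i)))
    rw [← hWe] at ho
    refine ⟨i, W ∩ U, inter_subset_right, hW.inter hU, ⟨z, ⟨ho, hzU⟩, z.2⟩, ?_⟩
    rintro y ⟨⟨hyW, -⟩, hyF⟩
    have : (⟨y, hyF⟩ : F) ∈ (↑) ⁻¹' W := hyW
    rw [hWe] at this
    exact (interior_subset this : (⟨y, hyF⟩ : F) ∈ D (some i))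

theorem IsFSigma.isGδ_compl {s : Set X} (h : IsFSigma s) : IsGδ sᶜ := by
  obtain ⟨C, hC, rfl⟩ := h
  rw [compl_iUnion]
  exact IsGδ.iInter_of_isOpen fun n => (hC n).isOpen_compl

end Discrete

section Image

variable {X Y : Type*} [MetricSpace Y] {f : X → Y}

theorem dist_le_of_ediam_image_le {s : Set X} {ε : ℝ} (hε : 0 ≤ ε)
    (h : Metric.ediam (f '' s) ≤ ENNReal.ofReal ε) {x y : X} (hx : x ∈ s) (hy : y ∈ s) :
    dist (f x) (f y) ≤ ε := by
  have := (Metric.edist_le_ediam_of_mem (mem_image_of_mem f hx) (mem_image_of_mem f hy)).trans h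
  rwa [edist_dist, ENNReal.ofReal_le_ofReal_iff hε] at this

theorem ediam_image_le_of_dist_le {s : Set X} {ε : ℝ}
    (h : ∀ x ∈ s, ∀ y ∈ s, dist (f x) (f y) ≤ ε) :
    Metric.ediam (f '' s) ≤ ENNReal.ofReal ε := by
  refine Metric.ediam_le ?_
  rintro _ ⟨x, hx, rfl⟩ _ ⟨y, hy, rfl⟩
  rw [edist_dist]
  exact ENNReal.ofReal_le_ofReal (h x hx y hy)

end Image

/-! ### Implications that need no metric on the domain. -/

section Topological

variable {X Y : Type*} [TopologicalSpace X] [MetricSpace Y] {f : X → Y}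

theorem HasGeneralizedLebesgueProperty.isWeaklySeparated
    (h : HasGeneralizedLebesgueProperty f) : IsWeaklySeparated f := by
  classical
  intro ε hε
  obtain ⟨𝒜, ⟨ℬ, hℬ, rfl⟩, hcov, hA⟩ := h (ε / 2) (half_pos hε)
  have hcl : ∀ n, IsClosed (⋃₀ ℬ n) := fun n =>
    (hℬ n).isClosed_sUnion fun A hAn => (hA A (mem_iUnion.2 ⟨n, hAn⟩)).1
  have hex : ∀ x, ∃ n, x ∈ ⋃₀ ℬ n := by
    intro x
    have hx : x ∈ ⋃₀ ⋃ n, ℬ n := hcov ▸ mem_univ x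
    obtain ⟨A, hAm, hxA⟩ := hx
    obtain ⟨n, hn⟩ := mem_iUnion.1 hAm
    exact ⟨n, A, hn, hxA⟩
  have hU : ∀ x, ∃ U : Set X, IsOpen U ∧ x ∈ U ∧
      {A ∈ ℬ (Nat.find (hex x)) | (U ∩ A).Nonempty}.Subsingleton := by
    intro x
    obtain ⟨U, hU, hs⟩ := hℬ (Nat.find (hex x)) x
    obtain ⟨W, hWU, hW, hxW⟩ := mem_nhds_iff.1 hU
    exact ⟨W, hW, hxW, hs.anti fun A hA =>
      ⟨hA.1, hA.2.mono (inter_subset_inter_left _ hWU)⟩⟩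
  choose U hUo hxU hUs using hU
  -- Avoiding the earlier unions forces mutually related points to have the same first index; `U x`
  -- then forces the same member.
  refine ⟨fun x => U x ∩ ⋂ n ∈ Finset.range (Nat.find (hex x)), (⋃₀ ℬ n)ᶜ,
    fun x => ⟨(hUo x).inter ?_, hxU x, ?_⟩, ?_⟩
  · exact isOpen_biInter_finset fun n _ => (hcl n).isOpen_compl
  · refine mem_iInter₂.2 fun n hn => ?_
    exact Nat.find_min (hex x) (Finset.mem_range.1 hn)
  · rintro x y ⟨hxy, hyx⟩
    have key : ∀ u v, u ∈ ⋂ n ∈ Finset.range (Nat.find (hex v)), (⋃₀ ℬ n)ᶜ →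
        Nat.find (hex v) ≤ Nat.find (hex u) := by
      intro u v huv
      by_contra hlt
      exact mem_iInter₂.1 huv _ (Finset.mem_range.2 (not_le.1 hlt)) (Nat.find_spec (hex u))
    have heq : Nat.find (hex y) = Nat.find (hex x) :=
      le_antisymm (key x y hxy.2) (key y x hyx.2)
    obtain ⟨A, hAx, hxA⟩ := Nat.find_spec (hex x)
    obtain ⟨B, hBy, hyB⟩ := Nat.find_spec (hex y)
    rw [heq] at hBy
    have hAB : A = B := hUs x ⟨hAx, x, hxU x, hxA⟩ ⟨hBy, y, hyx.1, hyB⟩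
    subst hAB
    have := dist_le_of_ediam_image_le (half_pos hε).le
      (hA A (mem_iUnion.2 ⟨_, hAx⟩)).2 hxA hyB
    linarith

/-- Each point of the preimage lies in a member of some small-diameter cover that stays inside the
preimage; within one discrete family such members have closed union. -/
theorem HasGeneralizedLebesgueProperty.isBorelOne
    (h : HasGeneralizedLebesgueProperty f) : IsBorelOne f := by
  intro V hV
  choose 𝒜 h𝒜 hcov hA using fun n : ℕ => h (1 / ((n : ℝ) + 1)) Nat.one_div_pos_of_nat
  choose ℬ hℬ hunion using h𝒜
  let S : ℕ → ℕ → Set X := fun n m => ⋃₀ {A ∈ ℬ n m | A ⊆ f ⁻¹' V}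
  refine ⟨fun k => S k.unpair.1 k.unpair.2, fun k => ?_, ?_⟩
  · refine ((hℬ _ _).mono (sep_subset _ _)).isClosed_sUnion fun A hAm => ?_
    refine (hA k.unpair.1 A ?_).1
    rw [hunion]
    exact mem_iUnion.2 ⟨_, hAm.1⟩
  · refine Subset.antisymm (fun x hx => ?_)
      (iUnion_subset fun k => sUnion_subset fun A hAm => hAm.2)
    obtain ⟨r, hr, hball⟩ := Metric.isOpen_iff.1 hV _ hx
    obtain ⟨n, hn⟩ := exists_nat_one_div_lt hr
    have hx' : x ∈ ⋃₀ 𝒜 n := hcov n ▸ mem_univ x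
    obtain ⟨A, hAm, hxA⟩ := hx'
    have hdiam := (hA n A hAm).2
    rw [hunion] at hAm
    obtain ⟨m, hm⟩ := mem_iUnion.1 hAm
    refine mem_iUnion.2 ⟨Nat.pair n m, ?_⟩
    simp only [Nat.unpair_pair]
    refine ⟨A, ⟨hm, fun y hy => hball ?_⟩, hxA⟩
    rw [Metric.mem_ball]
    exact (dist_le_of_ediam_image_le Nat.one_div_pos_of_nat.le hdiam hy hxA).trans_lt hn

theorem HasLebesgueProperty.hasGeneralizedLebesgueProperty
    (h : HasLebesgueProperty f) : HasGeneralizedLebesgueProperty f := by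
  intro ε hε
  obtain ⟨A, hcov, hA⟩ := h ε hε
  refine ⟨range A, ⟨fun n => {A n}, fun n => isDiscreteFamily_singleton _, ?_⟩, ?_, ?_⟩
  · rw [iUnion_singleton_eq_range]
  · rwa [sUnion_range]
  · rintro _ ⟨n, rfl⟩
    exact hA n

theorem IsBorelOne.hasLebesgueProperty [TopologicalSpace.SeparableSpace Y]
    (h : IsBorelOne f) : HasLebesgueProperty f := by
  intro ε hε
  rcases isEmpty_or_nonempty Y with hY | hY
  · have : IsEmpty X := f.isEmpty
    refine ⟨fun _ => ∅, Subsingleton.elim _ _, fun n => ⟨isClosed_empty, by simp⟩⟩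
  choose C hC hCe using fun k =>
    h (Metric.ball (TopologicalSpace.denseSeq Y k) (ε / 2)) Metric.isOpen_ball
  refine ⟨fun k => C k.unpair.1 k.unpair.2, eq_univ_of_forall fun x => ?_, fun k =>
    ⟨hC _ _, ediam_image_le_of_dist_le fun x hx y hy => ?_⟩⟩
  · obtain ⟨k, hk⟩ := (TopologicalSpace.denseRange_denseSeq Y).exists_dist_lt (f x) (half_pos hε)
    have hx : x ∈ f ⁻¹' Metric.ball (TopologicalSpace.denseSeq Y k) (ε / 2) := hk
    rw [hCe] at hx
    obtain ⟨m, hm⟩ := mem_iUnion.1 hx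
    refine mem_iUnion.2 ⟨Nat.pair k m, ?_⟩
    simpa only [Nat.unpair_pair] using hm
  · have key : ∀ z ∈ C k.unpair.1 k.unpair.2,
        dist (f z) (TopologicalSpace.denseSeq Y k.unpair.1) < ε / 2 := by
      intro z hz
      have : z ∈ f ⁻¹' Metric.ball (TopologicalSpace.denseSeq Y k.unpair.1) (ε / 2) := by
        rw [hCe]; exact mem_iUnion.2 ⟨_, hz⟩
      exact this
    have := dist_triangle_right (f x) (f y) (TopologicalSpace.denseSeq Y k.unpair.1)
    linarith [key x hx, key y hy]

/-- `f` is weakly separated at scale `ε` on the open set `W` by neighbourhoods inside `W`. -/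
def IsWeaklySeparatedOn (f : X → Y) (ε : ℝ) (W : Set X) : Prop :=
  ∃ V : X → Set X, (∀ x ∈ W, IsOpen (V x) ∧ x ∈ V x ∧ V x ⊆ W) ∧
    ∀ x ∈ W, ∀ y ∈ W, x ∈ V y → y ∈ V x → dist (f x) (f y) < ε

/-- Each point uses the neighbourhood from the well-order-least member containing it. Neighbourhoods
stay inside their member, so two mutually related points have the same least member. -/
theorem isWeaklySeparatedOn_sUnion {ε : ℝ} {𝒲 : Set (Set X)}
    (h : ∀ W ∈ 𝒲, IsWeaklySeparatedOn f ε W) : IsWeaklySeparatedOn f ε (⋃₀ 𝒲) := by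
  classical
  choose! V hV hd using h
  have wf : WellFounded (WellOrderingRel : Set X → Set X → Prop) := IsWellFounded.wf
  have hex : ∀ x, ∃ W, x ∈ ⋃₀ 𝒲 → (W ∈ 𝒲 ∧ x ∈ W) ∧
      ∀ W', W' ∈ 𝒲 → x ∈ W' → ¬ WellOrderingRel W' W := by
    intro x
    by_cases hx : x ∈ ⋃₀ 𝒲
    · have hne : {W | W ∈ 𝒲 ∧ x ∈ W}.Nonempty := by
        obtain ⟨W, hW⟩ := hx
        exact ⟨W, hW⟩
      exact ⟨wf.min _ hne, fun _ => ⟨wf.min_mem _ hne, fun W' h1 h2 =>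
        wf.not_lt_min _ (show W' ∈ {W | W ∈ 𝒲 ∧ x ∈ W} from ⟨h1, h2⟩)⟩⟩
    · exact ⟨∅, fun h => absurd h hx⟩
  choose w hw hmin using hex
  refine ⟨fun x => V (w x) x, fun x hx => ?_, fun x hx y hy hxy hyx => ?_⟩
  · obtain ⟨h1, h2, h3⟩ := hV _ (hw x hx).1 x (hw x hx).2
    exact ⟨h1, h2, h3.trans (subset_sUnion_of_mem (hw x hx).1)⟩
  · have hxw : x ∈ w y := (hV _ (hw y hy).1 y (hw y hy).2).2.2 hxy
    have hyw : y ∈ w x := (hV _ (hw x hx).1 x (hw x hx).2).2.2 hyx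
    have heq : w x = w y := by
      rcases trichotomous_of WellOrderingRel (w x) (w y) with h | h | h
      · exact absurd h (hmin y hy _ (hw x hx).1 hyw)
      · exact h
      · exact absurd h (hmin x hx _ (hw y hy).1 hxw)
    refine hd _ (hw x hx).1 x (hw x hx).2 y hyw ?_ hyx
    rw [heq]
    exact hxy

theorem IsFragmentable.isWeaklySeparated (h : IsFragmentable f) : IsWeaklySeparated f := by
  classical
  intro ε hε
  let W : Set X := ⋃₀ {W | IsWeaklySeparatedOn f ε W}
  have hW : IsWeaklySeparatedOn f ε W := isWeaklySeparatedOn_sUnion fun _ h => h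
  obtain ⟨V, hV, hd⟩ := hW
  have hWo : IsOpen W := isOpen_iff_forall_mem_open.2 fun x hx =>
    ⟨V x, (hV x hx).2.2, (hV x hx).1, (hV x hx).2.1⟩
  have huniv : W = univ := by
    by_contra hne
    obtain ⟨U, hU, ⟨z, hzU, hzW⟩, hdiam⟩ :=
      h ε hε Wᶜ (nonempty_compl.2 hne) hWo.isClosed_compl
    -- Old neighbourhoods stay inside `W`, so an old and a new point are never mutually related; two
    -- new points lie in `U ∩ Wᶜ`, whose image is small.
    have hgood : IsWeaklySeparatedOn f ε (W ∪ U) := by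
      refine ⟨fun x => if x ∈ W then V x else U, ?_, ?_⟩
      · intro x hx
        by_cases hxW : x ∈ W
        · simp only [hxW, if_true]
          exact ⟨(hV x hxW).1, (hV x hxW).2.1, (hV x hxW).2.2.trans subset_union_left⟩
        · simp only [hxW, if_false]
          exact ⟨hU, hx.resolve_left hxW, subset_union_right⟩
      · intro x hx y hy hxy hyx
        by_cases hxW : x ∈ W
        · simp only [hxW, if_true] at hyx
          have hyW := (hV x hxW).2.2 hyx
          simp only [hyW, if_true] at hxy
          exact hd x hxW y hyW hxy hyx
        · by_cases hyW : y ∈ W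
          · simp only [hyW, if_true] at hxy
            exact absurd ((hV y hyW).2.2 hxy) hxW
          · have := (Metric.edist_le_ediam_of_mem
              (mem_image_of_mem f (show x ∈ U ∩ Wᶜ from ⟨hx.resolve_left hxW, hxW⟩))
              (mem_image_of_mem f (show y ∈ U ∩ Wᶜ from ⟨hy.resolve_left hyW, hyW⟩))).trans_lt
              hdiam
            rwa [edist_dist, ENNReal.ofReal_lt_ofReal_iff hε] at this
    exact hzW (subset_sUnion_of_mem (t := W ∪ U) hgood (Or.inr hzU))
  refine ⟨V, fun x => ?_, fun x y hxy => ?_⟩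
  · have hx : x ∈ W := huniv ▸ mem_univ x
    exact ⟨(hV x hx).1, (hV x hx).2.1⟩
  · exact hd x (huniv ▸ mem_univ x) y (huniv ▸ mem_univ y) hxy.1 hxy.2

theorem HasPointOfContinuityProperty.isFragmentable
    (h : HasPointOfContinuityProperty f) : IsFragmentable f := by
  intro ε hε F hne hF
  obtain ⟨x, hx⟩ := h F hne hF
  have hmem : {z : F | dist (f z) (f x) < ε / 3} ∈ 𝓝 x :=
    hx (Metric.ball_mem_nhds _ (by positivity))
  rw [mem_nhds_subtype] at hmem
  obtain ⟨U, hU, hsub⟩ := hmem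
  obtain ⟨W, hWU, hW, hxW⟩ := mem_nhds_iff.1 hU
  refine ⟨W, hW, ⟨x, hxW, x.2⟩, lt_of_le_of_lt (ediam_image_le_of_dist_le (ε := 2 * (ε / 3)) ?_)
    ((ENNReal.ofReal_lt_ofReal_iff hε).2 (by linarith))⟩
  rintro y ⟨hyW, hyF⟩ z ⟨hzW, hzF⟩
  have h1 : dist (f y) (f x) < ε / 3 :=
    hsub (show (⟨y, hyF⟩ : F) ∈ Subtype.val ⁻¹' U from hWU hyW)
  have h2 : dist (f z) (f x) < ε / 3 :=
    hsub (show (⟨z, hzF⟩ : F) ∈ Subtype.val ⁻¹' U from hWU hzW)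
  linarith [dist_triangle_right (f y) (f z) (f x)]

theorem IsFragmentable.hasPointOfContinuityProperty (hX : HereditarilyBaire X)
    (h : IsFragmentable f) : HasPointOfContinuityProperty f := by
  intro F hne hF
  have : BaireSpace F := hX F hF
  let O : ℕ → Set F := fun n => ⋃₀ {O | IsOpen O ∧
    Metric.ediam ((fun z : F => f z) '' O) ≤ ENNReal.ofReal (1 / ((n : ℝ) + 1))}
  have hO : ∀ n, IsOpen (O n) := fun n => isOpen_sUnion fun _ h => h.1
  have hd : ∀ n, Dense (O n) := by
    intro n
    refine dense_iff_inter_open.2 fun S hS hSne => ?_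
    obtain ⟨W, hW, rfl⟩ := isOpen_induced_iff.1 hS
    obtain ⟨z, hz⟩ := hSne
    -- `W ∩ F` need not be closed, hence the closure; an open set meeting the closure meets `W ∩ F`
    -- itself.
    obtain ⟨U, hU, hUne, hdiam⟩ := h (1 / ((n : ℝ) + 1)) Nat.one_div_pos_of_nat
      (closure (W ∩ F)) ⟨z, subset_closure ⟨hz, z.2⟩⟩ isClosed_closure
    obtain ⟨u, huc, huU⟩ := hUne.imp fun _ h => h.symm
    obtain ⟨v, hvU, hvW, hvF⟩ := mem_closure_iff.1 huc U hU huU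
    refine ⟨⟨v, hvF⟩, hvW, (↑) ⁻¹' (U ∩ W),
      ⟨(hU.inter hW).preimage continuous_subtype_val, ?_⟩, hvU, hvW⟩
    refine le_trans (Metric.ediam_mono ?_) hdiam.le
    rintro _ ⟨y, ⟨hyU, hyW⟩, rfl⟩
    exact ⟨y, ⟨hyU, subset_closure ⟨hyW, y.2⟩⟩, rfl⟩
  have : Nonempty F := hne.to_subtype
  obtain ⟨x, hx⟩ := (dense_iInter_of_isOpen_nat hO hd).nonempty
  refine ⟨x, Metric.tendsto_nhds.2 fun ε hε => ?_⟩
  obtain ⟨n, hn⟩ := exists_nat_one_div_lt hε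
  obtain ⟨S, ⟨hS, hdiam⟩, hxS⟩ := mem_iInter.1 hx n
  filter_upwards [hS.mem_nhds hxS] with y hy
  exact (dist_le_of_ediam_image_le (f := fun z : F => f z) Nat.one_div_pos_of_nat.le hdiam
    hy hxS).trans_lt hn

end Topological

/-- Recursive choice where each term is chosen subject to a condition on all earlier ones. -/
theorem exists_seq_of_forall_prefix {α : Type*} [Nonempty α] (R : ℕ → (ℕ → α) → α → Prop)
    (hR : ∀ n x x' y, (∀ i ≤ n, x i = x' i) → R n x y → R n x' y)
    (h : ∀ n x, ∃ y, R n x y) : ∃ x : ℕ → α, ∀ n, R n x (x (n + 1)) := by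
  choose g hg using h
  -- `H n` holds the terms up to `n`; later updates leave them alone, so the diagonal is the
  -- sequence.
  let H : ℕ → ℕ → α := fun n =>
    Nat.rec (fun _ => Classical.arbitrary α) (fun n h => Function.update h (n + 1) (g n h)) n
  have hsucc : ∀ n, H (n + 1) = Function.update (H n) (n + 1) (g n (H n)) := fun _ => rfl
  have hpre : ∀ n, ∀ i ≤ n, H n i = H i i := by
    intro n
    induction n with
    | zero => intro i hi; rw [Nat.le_zero.1 hi]
    | succ n ih =>
      intro i hi
      rcases Nat.le_succ_iff.1 hi with hi | rfl
      · rw [hsucc, Function.update_of_ne (by omega), ih i hi]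
      · rfl
  refine ⟨fun n => H n n, fun n => ?_⟩
  have : H (n + 1) (n + 1) = g n (H n) := by rw [hsucc, Function.update_self]
  simp only [this]
  exact hR n (H n) _ _ (hpre n) (hg n _)

/-! ### Implications using the metric of the domain. -/

section Metric

variable {X Y : Type*} [MetricSpace X] [MetricSpace Y] {f : X → Y}

theorem isWeaklySeparated_iff_hasLTZProperty : IsWeaklySeparated f ↔ HasLTZProperty f := by
  constructor
  · intro h ε hε
    obtain ⟨V, hV, hd⟩ := h ε hε
    choose δ hδ hball using fun x => Metric.isOpen_iff.1 (hV x).1 x (hV x).2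
    refine ⟨δ, hδ, fun x y hxy => hd x y ⟨hball y ?_, hball x ?_⟩⟩
    · exact hxy.trans_le (min_le_right _ _)
    · rw [Metric.mem_ball']
      exact hxy.trans_le (min_le_left _ _)
  · intro h ε hε
    obtain ⟨δ, hδ, hd⟩ := h ε hε
    refine ⟨fun x => Metric.ball x (δ x),
      fun x => ⟨Metric.isOpen_ball, Metric.mem_ball_self (hδ x)⟩, fun x y hxy => hd x y ?_⟩
    exact lt_min (Metric.mem_ball'.1 hxy.2) hxy.1

theorem HasLTZProperty.exists_closed_cover (h : HasLTZProperty f) {ε : ℝ} (hε : 0 < ε) :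
    ∃ C : ℕ → Set X, (∀ n, IsClosed (C n)) ∧ (⋃ n, C n) = univ ∧
      ∀ n, ∀ x ∈ C n, ∀ y ∈ C n, dist x y < 1 / ((n : ℝ) + 1) → dist (f x) (f y) ≤ ε := by
  obtain ⟨δ, hδ, hd⟩ := h (ε / 3) (by positivity)
  refine ⟨fun n => closure {x | 1 / ((n : ℝ) + 1) < δ x}, fun n => isClosed_closure,
    eq_univ_of_forall fun x => ?_, fun n x hx y hy hxy => ?_⟩
  · obtain ⟨n, hn⟩ := exists_nat_one_div_lt (hδ x)
    exact mem_iUnion.2 ⟨n, subset_closure hn⟩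
  · have hr : (0 : ℝ) < 1 / ((n : ℝ) + 1) := Nat.one_div_pos_of_nat
    have hgap : 0 < (1 / ((n : ℝ) + 1) - dist x y) / 2 := by linarith
    have key : ∀ z ∈ closure {x | 1 / ((n : ℝ) + 1) < δ x}, ∃ z', 1 / ((n : ℝ) + 1) < δ z' ∧
        dist z z' < (1 / ((n : ℝ) + 1) - dist x y) / 2 ∧ dist (f z) (f z') < ε / 3 := by
      intro z hz
      -- Closeness within `δ z` controls the image; within half the slack, it keeps the approximants
      -- of `x` and `y` closer than `1/(n+1)`.
      obtain ⟨z', hz', hdz⟩ := Metric.mem_closure_iff.1 hz _ (lt_min hgap (hδ z))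
      refine ⟨z', hz', hdz.trans_le (min_le_left _ _), hd _ _ (lt_min ?_ ?_)⟩
      · exact hdz.trans_le (min_le_right _ _)
      · have h1 := hdz.trans_le (min_le_left _ _)
        have h2 : 1 / ((n : ℝ) + 1) < δ z' := hz'
        linarith [dist_nonneg (x := x) (y := y)]
    obtain ⟨x', hx', hdx, hfx⟩ := key x hx
    obtain ⟨y', hy', hdy, hfy⟩ := key y hy
    have hxy' : dist x' y' < 1 / ((n : ℝ) + 1) := by
      have := dist_triangle4 x' x y y'
      rw [dist_comm x' x] at this
      linarith
    have hf := hd x' y' (lt_min (hxy'.trans hx') (hxy'.trans hy'))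
    have := dist_triangle4 (f x) (f x') (f y') (f y)
    rw [dist_comm (f y') (f y)] at this
    linarith

/-- Every metric space has a `σ`-discrete cover by closed sets of small diameter. -/
theorem exists_isDiscreteFamily_cover (X : Type*) [MetricSpace X] {r : ℝ} (hr : 0 < r) :
    ∃ ℬ : ℕ → Set (Set X), (∀ n, IsDiscreteFamily (ℬ n)) ∧ ⋃₀ (⋃ n, ℬ n) = univ ∧
      ∀ n, ∀ A ∈ ℬ n, IsClosed A ∧ ∀ x ∈ A, ∀ y ∈ A, dist x y < r := by
  have wf : WellFounded (WellOrderingRel : X → X → Prop) := IsWellFounded.wf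
  -- Stone's construction: `z` belongs to its least centre within `r/2`, and the margin `1/(n+1)`
  -- keeps the pieces of level `n` apart.
  let A : ℕ → X → Set X := fun n x =>
    {z | dist z x ≤ r / 2 - 1 / ((n : ℝ) + 1)} ∩ ⋂ y ∈ {y | WellOrderingRel y x},
      {z | r / 2 ≤ dist z y}
  have hsep : ∀ n x y, WellOrderingRel x y → ∀ u ∈ A n x, ∀ v ∈ A n y,
      1 / ((n : ℝ) + 1) ≤ dist u v := by
    intro n x y hxy u hu v hv
    have h1 : dist u x ≤ r / 2 - 1 / ((n : ℝ) + 1) := hu.1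
    have h2 : r / 2 ≤ dist v x := mem_iInter₂.1 hv.2 x hxy
    have := dist_triangle_left v x u
    linarith
  refine ⟨fun n => range (A n), fun n x => ?_, eq_univ_of_forall fun z => ?_, ?_⟩
  · have hn : (0 : ℝ) < 1 / ((n : ℝ) + 1) := Nat.one_div_pos_of_nat
    refine ⟨Metric.ball x (1 / ((n : ℝ) + 1) / 2), Metric.ball_mem_nhds _ (by positivity), ?_⟩
    rintro _ ⟨⟨p, rfl⟩, u, hu, hup⟩ _ ⟨⟨q, rfl⟩, v, hv, hvq⟩
    have hlt : dist u v < 1 / ((n : ℝ) + 1) := by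
      have := dist_triangle_right u v x
      rw [Metric.mem_ball] at hu hv
      linarith
    rcases trichotomous_of WellOrderingRel p q with h | h | h
    · exact absurd (hsep n p q h u hup v hvq) (not_le.2 hlt)
    · rw [h]
    · exact absurd (hsep n q p h v hvq u hup) (not_le.2 (by rwa [dist_comm]))
  · have hne : {x | dist z x < r / 2}.Nonempty := ⟨z, by simpa using hr⟩
    have hmin : dist z (wf.min _ hne) < r / 2 := wf.min_mem _ hne
    obtain ⟨n, hn⟩ := exists_nat_one_div_lt (sub_pos.2 hmin)
    refine ⟨A n (wf.min _ hne), mem_iUnion.2 ⟨n, _, rfl⟩, ?_, mem_iInter₂.2 fun y hy => ?_⟩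
    · have : dist z (wf.min _ hne) ≤ r / 2 - 1 / ((n : ℝ) + 1) := by linarith
      exact this
    · by_contra hlt
      have hlt' : dist z y < r / 2 := not_le.1 hlt
      exact wf.not_lt_min {x | dist z x < r / 2} hlt' hy
  · rintro n _ ⟨x, rfl⟩
    refine ⟨IsClosed.inter ?_ (isClosed_biInter fun y _ => ?_), fun u hu v hv => ?_⟩
    · exact isClosed_le (by fun_prop) continuous_const
    · exact isClosed_le continuous_const (by fun_prop)
    · have hn : (0 : ℝ) < 1 / ((n : ℝ) + 1) := Nat.one_div_pos_of_nat
      have h1 : dist u x ≤ r / 2 - 1 / ((n : ℝ) + 1) := hu.1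
      have h2 : dist v x ≤ r / 2 - 1 / ((n : ℝ) + 1) := hv.1
      linarith [dist_triangle_right u v x]

theorem HasLTZProperty.hasGeneralizedLebesgueProperty (h : HasLTZProperty f) :
    HasGeneralizedLebesgueProperty f := by
  intro ε hε
  obtain ⟨C, hC, hcov, hd⟩ := h.exists_closed_cover hε
  choose ℬ hℬ hBcov hB using fun n : ℕ =>
    exists_isDiscreteFamily_cover X (r := 1 / ((n : ℝ) + 1)) Nat.one_div_pos_of_nat
  let 𝒟 : ℕ → ℕ → Set (Set X) := fun n m => (fun A => C n ∩ A) '' ℬ n m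
  refine ⟨⋃ k : ℕ, 𝒟 k.unpair.1 k.unpair.2, ⟨_, fun k x => ?_, rfl⟩,
    eq_univ_of_forall fun x => ?_, fun A hA => ?_⟩
  · obtain ⟨U, hU, hs⟩ := hℬ k.unpair.1 k.unpair.2 x
    refine ⟨U, hU, ?_⟩
    rintro _ ⟨⟨A, hA, rfl⟩, hUA⟩ _ ⟨⟨B, hB, rfl⟩, hUB⟩
    have : A = B := hs ⟨hA, hUA.mono (by gcongr; exact inter_subset_right)⟩
      ⟨hB, hUB.mono (by gcongr; exact inter_subset_right)⟩
    rw [this]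
  · obtain ⟨n, hn⟩ := mem_iUnion.1 (hcov ▸ mem_univ x : x ∈ ⋃ n, C n)
    obtain ⟨A, hA, hxA⟩ := (hBcov n ▸ mem_univ x : x ∈ ⋃₀ ⋃ m, ℬ n m)
    obtain ⟨m, hm⟩ := mem_iUnion.1 hA
    refine ⟨C n ∩ A, mem_iUnion.2 ⟨Nat.pair n m, ?_⟩, hn, hxA⟩
    simp only [Nat.unpair_pair]
    exact mem_image_of_mem _ hm
  · obtain ⟨k, B, hBk, rfl⟩ := mem_iUnion.1 hA
    obtain ⟨hcl, hdist⟩ := hB _ _ B hBk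
    exact ⟨(hC _).inter hcl, ediam_image_le_of_dist_le fun x hx y hy =>
      hd _ x hx.1 y hy.1 (hdist x hx.2 y hy.2)⟩

theorem HasLTZProperty.hasLebesgueProperty [TopologicalSpace.SeparableSpace X]
    (h : HasLTZProperty f) : HasLebesgueProperty f := by
  intro ε hε
  rcases isEmpty_or_nonempty X with hX | hX
  · exact ⟨fun _ => ∅, Subsingleton.elim _ _, fun n => ⟨isClosed_empty, by simp⟩⟩
  obtain ⟨C, hC, hcov, hd⟩ := h.exists_closed_cover hε
  refine ⟨fun k => C k.unpair.1 ∩ Metric.closedBall (TopologicalSpace.denseSeq X k.unpair.2)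
    (1 / ((k.unpair.1 : ℝ) + 1) / 3), eq_univ_of_forall fun x => ?_, fun k =>
    ⟨(hC _).inter Metric.isClosed_closedBall, ediam_image_le_of_dist_le fun x hx y hy =>
      hd _ x hx.1 y hy.1 ?_⟩⟩
  · obtain ⟨n, hn⟩ := mem_iUnion.1 (hcov ▸ mem_univ x : x ∈ ⋃ n, C n)
    obtain ⟨m, hm⟩ := (TopologicalSpace.denseRange_denseSeq X).exists_dist_lt x
      (ε := 1 / ((n : ℝ) + 1) / 3) (by positivity)
    refine mem_iUnion.2 ⟨Nat.pair n m, ?_⟩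
    simp only [Nat.unpair_pair]
    exact ⟨hn, hm.le⟩
  · have hpos : (0 : ℝ) < 1 / ((k.unpair.1 : ℝ) + 1) := Nat.one_div_pos_of_nat
    have h1 := Metric.mem_closedBall.1 hx.2
    have h2 := Metric.mem_closedBall.1 hy.2
    linarith [dist_triangle_right x y (TopologicalSpace.denseSeq X k.unpair.2)]

theorem HasLTZProperty.isFragmentable (hX : HereditarilyBaire X) (h : HasLTZProperty f) :
    IsFragmentable f := by
  intro ε hε F hne hF
  have : BaireSpace F := hX F hF
  obtain ⟨C, hC, hcov, hd⟩ := h.exists_closed_cover (half_pos hε)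
  obtain ⟨n, W, -, hW, ⟨z, hzW, hzF⟩, hsub⟩ :=
    exists_isOpen_inter_subset_of_subset_iUnion (F := F) isOpen_univ (by simpa using hne) hC
      (by rw [hcov]; exact subset_univ _)
  have hn : (0 : ℝ) < 1 / ((n : ℝ) + 1) := Nat.one_div_pos_of_nat
  refine ⟨W ∩ Metric.ball z (1 / ((n : ℝ) + 1) / 2), hW.inter Metric.isOpen_ball,
    ⟨z, ⟨hzW, Metric.mem_ball_self (half_pos hn)⟩, hzF⟩,
    lt_of_le_of_lt (ediam_image_le_of_dist_le (ε := ε / 2) ?_)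
    ((ENNReal.ofReal_lt_ofReal_iff hε).2 (half_lt_self hε))⟩
  rintro x ⟨⟨hxW, hxz⟩, hxF⟩ y ⟨⟨hyW, hyz⟩, hyF⟩
  refine hd n x (hsub ⟨hxW, hxF⟩) y (hsub ⟨hyW, hyF⟩) ?_
  rw [Metric.mem_ball] at hxz hyz
  linarith [dist_triangle_right x y z]

/-- For a Borel one map that is nowhere of small oscillation on a Baire subspace, the image of an
open set has no finite net. -/
theorem IsBorelOne.exists_forall_le_dist (h : IsBorelOne f) {F : Set X} [BaireSpace F] {ε : ℝ}
    (hε : 0 < ε)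
    (hosc : ∀ U : Set X, IsOpen U → (U ∩ F).Nonempty →
      ENNReal.ofReal ε ≤ Metric.ediam (f '' (U ∩ F)))
    {U : Set X} (hU : IsOpen U) (hne : (U ∩ F).Nonempty) (t : Finset Y) :
    ∃ x ∈ U ∩ F, ∀ y ∈ t, ε / 4 ≤ dist (f x) y := by
  by_contra! hcon
  choose C hC hCe using fun y : Y => h (Metric.ball y (ε / 4)) Metric.isOpen_ball
  obtain ⟨⟨y, n⟩, W, -, hW, hWne, hsub⟩ :=
    exists_isOpen_inter_subset_of_subset_iUnion (F := F) (ι := t × ℕ) hU hne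
      (C := fun p => C p.1 p.2) (fun p => hC _ _) (fun x hx => by
        obtain ⟨y, hy, hlt⟩ := hcon x hx
        have hx' : x ∈ f ⁻¹' Metric.ball y (ε / 4) := hlt
        rw [hCe] at hx'
        obtain ⟨n, hn⟩ := mem_iUnion.1 hx'
        exact mem_iUnion.2 ⟨⟨⟨y, hy⟩, n⟩, hn⟩)
  refine absurd (hosc W hW hWne) (not_le.2 (lt_of_le_of_lt
    (ediam_image_le_of_dist_le (ε := ε / 2) ?_)
    ((ENNReal.ofReal_lt_ofReal_iff hε).2 (half_lt_self hε))))
  have key : ∀ z ∈ W ∩ F, dist (f z) y < ε / 4 := by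
    intro z hz
    have : z ∈ f ⁻¹' Metric.ball (y : Y) (ε / 4) := by
      rw [hCe]; exact mem_iUnion.2 ⟨n, hsub hz⟩
    exact this
  intro u hu v hv
  linarith [key u hu, key v hv, dist_triangle_right (f u) (f v) y]

theorem IsBorelOne.isFragmentable (hX : HereditarilyBaire X) (h : IsBorelOne f) :
    IsFragmentable f := by
  classical
  intro ε hε F hne hF
  by_contra! hosc
  have : BaireSpace F := hX F hF
  have : Nonempty F := hne.to_subtype
  -- Term `n + 1` approximates term `n.unpair.1`, so each term is approximated infinitely often,
  -- while its value stays `ε/4` from all earlier ones.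
  obtain ⟨x, hx⟩ := exists_seq_of_forall_prefix (α := F)
    (fun n x y => dist (y : X) (x n.unpair.1) < 1 / ((n : ℝ) + 1) ∧
      ∀ i ≤ n, ε / 4 ≤ dist (f y) (f (x i)))
    (by
      rintro n x x' y hxx ⟨h1, h2⟩
      refine ⟨?_, fun i hi => ?_⟩
      · rwa [← hxx _ (Nat.unpair_left_le n)]
      · rw [← hxx i hi]; exact h2 i hi)
    (by
      intro n x
      obtain ⟨y, ⟨hyb, hyF⟩, hy⟩ := h.exists_forall_le_dist hε hosc
        (U := Metric.ball (x n.unpair.1 : X) (1 / ((n : ℝ) + 1))) Metric.isOpen_ball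
        ⟨x n.unpair.1, Metric.mem_ball_self Nat.one_div_pos_of_nat, (x n.unpair.1).2⟩
        ((Finset.range (n + 1)).image fun i => f (x i))
      exact ⟨⟨y, hyF⟩, hyb, fun i hi => hy _ (Finset.mem_image_of_mem _
        (Finset.mem_range.2 (Nat.lt_succ_of_le hi)))⟩)
  have hsep : ∀ i j, i ≠ j → ε / 4 ≤ dist (f (x i)) (f (x j)) := by
    have key : ∀ i j, i < j → ε / 4 ≤ dist (f (x j)) (f (x i)) := by
      intro i j hij
      obtain ⟨n, rfl⟩ := Nat.exists_eq_succ_of_ne_zero (Nat.ne_of_gt (Nat.zero_lt_of_lt hij))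
      exact (hx n).2 i (Nat.le_of_lt_succ hij)
    intro i j hij
    rcases lt_or_gt_of_ne hij with hij | hij
    · rw [dist_comm]; exact key i j hij
    · exact key j i hij
  let G : Set X := closure (range fun n => (x n : X))
  have : BaireSpace G := hX G isClosed_closure
  have : Nonempty G := ⟨⟨x 0, subset_closure ⟨0, rfl⟩⟩⟩
  -- The parity `b` of the second pairing coordinate splits the approximants into two classes, each
  -- accumulating at every term; their value sets are disjoint and, being uniformly separated,
  -- closed.
  let T : ℕ → Set Y := fun b => range fun p : ℕ × ℕ => f (x (Nat.pair p.1 (2 * p.2 + b) + 1))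
  have hTc : ∀ b, IsClosed (T b) := by
    intro b
    refine Metric.isClosed_of_pairwise_le_dist (ε := ε / 4) (by positivity) ?_
    rintro _ ⟨p, rfl⟩ _ ⟨q, rfl⟩ hne'
    exact hsep _ _ fun heq => hne' (by simp only [heq])
  have hTδ : ∀ b, IsGδ ((↑) ⁻¹' (f ⁻¹' T b) : Set G) := by
    intro b
    have := (h (T b)ᶜ (hTc b).isOpen_compl).isGδ_compl
    rw [preimage_compl, compl_compl] at this
    exact this.preimage continuous_subtype_val
  have hTd : ∀ b, Dense ((↑) ⁻¹' (f ⁻¹' T b) : Set G) := by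
    intro b
    refine dense_iff_inter_open.2 fun S hS hSne => ?_
    obtain ⟨W, hW, rfl⟩ := isOpen_induced_iff.1 hS
    obtain ⟨z, hz⟩ := hSne
    obtain ⟨_, hkW, k, rfl⟩ := mem_closure_iff.1 z.2 W hW hz
    obtain ⟨r, hr, hball⟩ := Metric.isOpen_iff.1 hW _ hkW
    obtain ⟨m, hm⟩ := exists_nat_one_div_lt hr
    -- The stage is at least `m`, so the approximant of `x k` made there is within `1/(m+1) < r`.
    have hle : m ≤ Nat.pair k (2 * m + b) := le_trans (by omega) (Nat.right_le_pair k (2 * m + b))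
    have hd := (hx (Nat.pair k (2 * m + b))).1
    simp only [Nat.unpair_pair] at hd
    refine ⟨⟨x (Nat.pair k (2 * m + b) + 1), subset_closure ⟨_, rfl⟩⟩, hball ?_, (k, m), rfl⟩
    rw [Metric.mem_ball]
    exact hd.trans_le ((Nat.one_div_le_one_div hle).trans hm.le)
  obtain ⟨z, ⟨p, hp⟩, ⟨q, hq⟩⟩ := ((hTd 0).inter_of_Gδ (hTδ 0) (hTδ 1) (hTd 1)).nonempty
  have hne' : Nat.pair p.1 (2 * p.2 + 0) + 1 ≠ Nat.pair q.1 (2 * q.2 + 1) + 1 := by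
    intro heq
    have := (Nat.pair_eq_pair.1 (Nat.succ_injective heq)).2
    omega
  have hcontra := hsep _ _ hne'
  rw [show f (x (Nat.pair p.1 (2 * p.2 + 0) + 1)) = f (x (Nat.pair q.1 (2 * q.2 + 1) + 1)) from
    hp.trans hq.symm, dist_self] at hcontra
  linarith

end Metric

theorem mainTheorem7 {X Y : Type*} [MetricSpace X] [MetricSpace Y]
    (hX : HereditarilyBaire X) (f : X → Y) :
    [HasGeneralizedLebesgueProperty f, IsWeaklySeparated f, HasLTZProperty f,
      HasPointOfContinuityProperty f, IsBorelOne f, IsFragmentable f].TFAE ∧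
    (TopologicalSpace.SeparableSpace X ∨ TopologicalSpace.SeparableSpace Y →
      [HasLebesgueProperty f, HasGeneralizedLebesgueProperty f, IsWeaklySeparated f,
        HasLTZProperty f, HasPointOfContinuityProperty f, IsBorelOne f,
        IsFragmentable f].TFAE) := by
  have glp_ws : HasGeneralizedLebesgueProperty f → IsWeaklySeparated f :=
    HasGeneralizedLebesgueProperty.isWeaklySeparated
  have ws_ltz : IsWeaklySeparated f → HasLTZProperty f := isWeaklySeparated_iff_hasLTZProperty.1
  have ltz_glp : HasLTZProperty f → HasGeneralizedLebesgueProperty f :=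
    HasLTZProperty.hasGeneralizedLebesgueProperty
  have ltz_frag : HasLTZProperty f → IsFragmentable f := HasLTZProperty.isFragmentable hX
  have frag_ws : IsFragmentable f → IsWeaklySeparated f := IsFragmentable.isWeaklySeparated
  have frag_pcp : IsFragmentable f → HasPointOfContinuityProperty f :=
    IsFragmentable.hasPointOfContinuityProperty hX
  have pcp_frag : HasPointOfContinuityProperty f → IsFragmentable f :=
    HasPointOfContinuityProperty.isFragmentable
  have glp_bor : HasGeneralizedLebesgueProperty f → IsBorelOne f :=
    HasGeneralizedLebesgueProperty.isBorelOne
  have bor_frag : IsBorelOne f → IsFragmentable f := IsBorelOne.isFragmentable hX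
  have main : [HasGeneralizedLebesgueProperty f, IsWeaklySeparated f, HasLTZProperty f,
      HasPointOfContinuityProperty f, IsBorelOne f, IsFragmentable f].TFAE := by
    tfae_have 1 → 2 := glp_ws
    tfae_have 2 → 3 := ws_ltz
    tfae_have 3 → 1 := ltz_glp
    tfae_have 3 → 6 := ltz_frag
    tfae_have 6 → 2 := frag_ws
    tfae_have 6 → 4 := frag_pcp
    tfae_have 4 → 6 := pcp_frag
    tfae_have 1 → 5 := glp_bor
    tfae_have 5 → 6 := bor_frag
    tfae_finish
  refine ⟨main, fun hsep => List.tfae_cons_cons.2 ⟨⟨fun h => h.hasGeneralizedLebesgueProperty,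
    fun h => ?_⟩, main⟩⟩
  rcases hsep with hs | hs
  · exact (ws_ltz (glp_ws h)).hasLebesgueProperty
  · exact (glp_bor h).hasLebesgueProperty
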